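/- Let $n\ge 2$ and let $\mathbb R_n$ be the real Clifford algebra generated by $e_1,\dots,e_n$ with $e_i^2=-1$ and $e_ie_j=-e_je_i$ for $i\ne j$, with basis $e_A=e_{i_1}\cdots e_{i_r}$ ($A=\{i_1<\dots<i_r\}$, $e_\emptyset=1$). For $x=\sum_A x_Ae_A$ write $\mathrm{Sc}(x)=x_\emptyset$, $|x|=(\sum_A x_A^2)^{1/2}$, and let $\overline{x}$ be the conjugate, i.e. the real-linear anti-automorphism with $\overline{e_i}=-e_i$. Paravectors $s=s_0+\sum_{i=1}^n s_ie_i$ are identified with elements of $\mathbb R^{n+1}$. Let $\Omega\subset\{(x_1,\dots,x_{n-1},y)\in\mathbb R^n: y>0\}$ be a (non-empty) open set with $$\inf_{(x,y)\in\Omega}y=m>0,\qquad \sup_{(x,y)\in\Omega}y=M<\infty ,$$ and write $y=x_n$. Let $\langle F,G\rangle_2=\int_\Omega\overline{F}\,G\,dx$ on $L^2(\Omega,\mathbb R_n)$ (Lebesgue measure), $\|F\|_2^2=\mathrm{Sc}\langle F,F\rangle_2$, let $H^1(\Omega,\mathbb R_n)$ be the space of $F\in L^2(\Omega,\mathbb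 R_n)$ whose first-order weak partial derivatives lie in $L^2(\Omega,\mathbb R_n)$, $\|F\|_D^2=\sum_{i=1}^n\|\partial_{x_i}F\|_2^2$, and let $H^1_0(\Omega,\mathbb R_n)$ be the closure of $C_c^\infty(\Omega,\mathbb R_n)$ in $H^1(\Omega,\mathbb R_n)$ for the norm $(\|F\|_2^2+\|F\|_D^2)^{1/2}$. Put $$\alpha_n=\frac{n-1}{2},\qquad \beta_n=\alpha_n+\alpha_n^2,\qquad \mathcal D_H=\sum_{i=1}^{n-1}e_i\,y\,\partial_{x_i}-\alpha_ne_n+e_n\,y\,\partial_y ,$$ and for $s\in\mathbb R^{n+1}$ and $F,G\in H^1_0(\Omega,\mathbb R_n)$ let $$q_s(F,G)=\sum_{i=1}^{n-1}\langle y^2\partial_{x_i}F,\partial_{x_i}G\rangle_2+\langle y^2\partial_yF,\partial_yG\rangle_2+2(1+\alpha_n)\langle y\,\partial_yF,G\rangle_2+\langle (e_n-2s_0)\mathcal D_HF,G\rangle_2+\langle(|s|^2-\beta_n)F,G\rangle_2 ,$$ the form associated with $Q_s(\mathcal D_H)F=f$ in $\Omega$, $F|_{\partial\Omega}=0$, where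 $Q_s(\mathcal D_H)=\mathcal D_H^2-2s_0\mathcal D_H+|s|^2$. Suppose that $s\in\mathbb R^{n+1}$ satisfies $|s|^2-\beta_n\neq0$ and $$\big||s|^2-\beta_n\big|-\alpha_n\sqrt{1+4s_0^2}+m^2>0,$$ $$4m^2\big||s|^2-\beta_n\big|-4nM^2s_0^2-4\big(m^2\alpha_n+M^2(1+\alpha_n)\sqrt n\big)\sqrt{1+4s_0^2}>M^2\big(4(1+\alpha_n)^2+n\big).$$ Then the constant $$K_{n,m,M}(s)=\tfrac12\big||s|^2-\beta_n\big|-\tfrac12\alpha_n\sqrt{1+4s_0^2}+\tfrac12m^2-\tfrac12\sqrt{\Big(\big||s|^2-\beta_n\big|-\alpha_n\sqrt{1+4s_0^2}-m^2\Big)^2+M^2\Big(2(1+\alpha_n)+\sqrt n\sqrt{1+4s_0^2}\Big)^2}$$ is positive, and for every $f\in L^2(\Omega,\mathbb R_n)$ there is a unique $F_f\in H^1_0(\Omega,\mathbb R_n)$ with $$q_s(F_f,G)=\langle f,G\rangle_2\qquad\text{for all }G\in H^1_0(\Omega,\mathbb R_n).$$ Moreover $Q_s(\mathcal D_H)^{-1}f:=F_f$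 satisfies $$\|Q_s(\mathcal D_H)^{-1}f\|_2\le\frac{1}{K_{n,m,M}(s)}\|f\|_2,\qquad \|Q_s(\mathcal D_H)^{-1}f\|_D\le\frac{1}{K_{n,m,M}(s)}\|f\|_2 .$$ -/

import Mathlib

open MeasureTheory Set
open scoped ContDiff

noncomputable section

namespace HypDirac

/-! ### The real Clifford algebra with `n` imaginary units -/

/-- The quadratic form `v ↦ -∑ vᵢ²` on `ℝⁿ`. -/
def quadForm (n : ℕ) : QuadraticForm ℝ (Fin n → ℝ) :=
  QuadraticMap.weightedSumSquares ℝ (fun _ : Fin n => (-1 : ℝ))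

theorem quadForm_apply {n : ℕ} (v : Fin n → ℝ) : quadForm n v = ∑ i, -(v i * v i) := by
  simp [quadForm, QuadraticMap.weightedSumSquares_apply]

/-- The Clifford algebra `ℝ_n`, generated by `e₁, …, e_n` with `eᵢ² = -1`, `eᵢ eⱼ = - eⱼ eᵢ`. -/
abbrev Cl (n : ℕ) : Type := CliffordAlgebra (quadForm n)

/-- The imaginary unit `eᵢ`. -/
def e {n : ℕ} (i : Fin n) : Cl n := CliffordAlgebra.ι (quadForm n) (Pi.single i 1)

/-- The basis vector `e_A = e_{i₁} ⋯ e_{i_r}` for `A = {i₁ < ⋯ < i_r}`. -/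
def eA {n : ℕ} (A : Finset (Fin n)) : Cl n := (A.sort.map e).prod

theorem e_mul_self {n : ℕ} (i : Fin n) : (e i : Cl n) * e i = -1 := by
  rw [e, CliffordAlgebra.ι_sq_scalar, quadForm_apply, Finset.sum_eq_single i]
  · simp
  · intro j _ hj
    simp [Pi.single_eq_of_ne hj]
  · simp

theorem e_mul_e {n : ℕ} {i j : Fin n} (h : i ≠ j) : (e i : Cl n) * e j = -(e j * e i) := by
  rw [eq_neg_iff_add_eq_zero, e, e, CliffordAlgebra.ι_mul_ι_add_swap, QuadraticMap.polar,
    quadForm_apply, quadForm_apply, quadForm_apply,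
    ← Finset.sum_sub_distrib, ← Finset.sum_sub_distrib, Finset.sum_eq_zero, map_zero]
  intro k _
  by_cases hi : k = i
  · subst hi
    simp [Pi.single_eq_of_ne h]
  · simp [Pi.single_eq_of_ne hi]

theorem eA_empty {n : ℕ} : (eA ∅ : Cl n) = 1 := by simp [eA]

theorem eA_insert {n : ℕ} {a : Fin n} {A : Finset (Fin n)} (h : ∀ b ∈ A, a < b) :
    (eA (insert a A) : Cl n) = e a * eA A := by
  rw [eA, Finset.sort_insert _ (fun b hb => (h b hb).le) (fun ha => lt_irrefl _ (h a ha))]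
  simp [eA]

theorem e_mul_eA_mem {n : ℕ} (i : Fin n) (A : Finset (Fin n)) :
    (e i : Cl n) * eA A ∈ Submodule.span ℝ (eA '' {B | B ⊆ insert i A}) := by
  induction A using Finset.induction_on_min with
  | empty =>
    refine Submodule.subset_span ⟨insert i ∅, by simp, ?_⟩
    rw [eA_insert (by simp)]
  | insert a A ha ih =>
    rcases lt_trichotomy i a with h | h | h
    · refine Submodule.subset_span ⟨insert i (insert a A), by simp, ?_⟩
      rw [eA_insert]
      intro b hb
      rcases Finset.mem_insert.1 hb with rfl | hb
      · exact h
      · exact h.trans (ha b hb)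
    · subst h
      rw [eA_insert ha, ← mul_assoc, e_mul_self, neg_one_mul]
      exact Submodule.neg_mem _ (Submodule.subset_span ⟨A, by
        intro x hx; simp [hx], rfl⟩)
    · rw [eA_insert ha, ← mul_assoc, e_mul_e h.ne', neg_mul, mul_assoc]
      refine Submodule.neg_mem _ ?_
      have : (e i : Cl n) * eA A ∈ (Submodule.span ℝ
          (eA '' {B | B ⊆ insert i (insert a A)})).comap (LinearMap.mulLeft ℝ (e a : Cl n)) := by
        refine Submodule.span_le.2 ?_ ih
        rintro _ ⟨B, hB, rfl⟩
        refine Submodule.subset_span ⟨insert a B, ?_, ?_⟩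
        · intro x hx
          rcases Finset.mem_insert.1 hx with rfl | hx
          · simp
          · have := hB hx
            simp only [Finset.mem_insert] at this ⊢
            tauto
        · rw [eA_insert]
          · rfl
          · intro b hb
            rcases Finset.mem_insert.1 (hB hb) with rfl | hb
            · exact h
            · exact ha b hb
      exact this

theorem span_eA (n : ℕ) : ⊤ ≤ Submodule.span ℝ (range (eA : Finset (Fin n) → Cl n)) := by
  intro x _
  induction x using CliffordAlgebra.left_induction with
  | algebraMap r =>
    rw [Algebra.algebraMap_eq_smul_one, ← eA_empty]
    exact Submodule.smul_mem _ _ (Submodule.subset_span ⟨∅, rfl⟩)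
  | add x y hx hy => exact Submodule.add_mem _ (hx trivial) (hy trivial)
  | ι_mul x m hx =>
    have hm : CliffordAlgebra.ι (quadForm n) m = ∑ i, m i • (e i : Cl n) := by
      simp only [e, ← map_smul, ← map_sum]
      congr 1
      ext j
      simp [Finset.sum_apply, Pi.single_apply]
    rw [hm, Finset.sum_mul]
    refine Submodule.sum_mem _ fun i _ => ?_
    rw [smul_mul_assoc]
    refine Submodule.smul_mem _ _ ?_
    have : x ∈ (Submodule.span ℝ (range (eA : Finset (Fin n) → Cl n))).comap
        (LinearMap.mulLeft ℝ (e i : Cl n)) := by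
      refine Submodule.span_le.2 ?_ (hx trivial)
      rintro _ ⟨B, rfl⟩
      exact Submodule.span_mono (image_subset_range _ _) (e_mul_eA_mem i B)
    exact this

theorem finrank_Cl (n : ℕ) : Fintype.card (Finset (Fin n)) = Module.finrank ℝ (Cl n) := by
  rw [(CliffordAlgebra.equivExterior (quadForm n)).finrank_eq,
    Module.finrank_eq_card_basis (Pi.basisFun ℝ (Fin n)).ExteriorAlgebra]

/-- The family `(e_A)` as a basis of `ℝ_n`. -/
def clBasis (n : ℕ) : Module.Basis (Finset (Fin n)) ℝ (Cl n) :=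
  basisOfTopLeSpanOfCardEqFinrank eA (span_eA n) (finrank_Cl n)

theorem clBasis_apply {n : ℕ} (A : Finset (Fin n)) : clBasis n A = eA A := by
  simp [clBasis]

/-- The coefficient `x_A` of a Clifford number `x = ∑ x_A e_A`. -/
def coeff {n : ℕ} (A : Finset (Fin n)) (x : Cl n) : ℝ := (clBasis n).repr x A

/-- The scalar part `Sc x = x_∅`. -/
def Sc {n : ℕ} (x : Cl n) : ℝ := coeff ∅ x

/-- The Euclidean scalar product `∑ x_A y_A` of Clifford numbers. -/
@[reducible] def clCore (n : ℕ) : InnerProductSpace.Core ℝ (Cl n) where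
  inner x y := ∑ A, coeff A x * coeff A y
  conj_inner_symm x y := by simp [mul_comm]
  re_inner_nonneg x := by
    simpa using Finset.sum_nonneg fun A _ => mul_self_nonneg (coeff A x)
  add_left x y z := by simp [coeff, add_mul, Finset.sum_add_distrib]
  smul_left x y r := by simp [coeff, Finset.mul_sum, mul_assoc]
  definite x hx := by
    refine (clBasis n).ext_elem fun A => ?_
    have h := (Finset.sum_eq_zero_iff_of_nonneg
      (fun A _ => mul_self_nonneg (coeff A x))).1 hx A (Finset.mem_univ A)
    simpa [coeff] using h

/-- `ℝ_n` carries the norm `|x| = (∑ x_A²)^{1/2}`. -/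
instance (n : ℕ) : NormedAddCommGroup (Cl n) := (clCore n).toNormedAddCommGroup

instance (n : ℕ) : InnerProductSpace ℝ (Cl n) := InnerProductSpace.ofCore (clCore n).toCore

theorem norm_sq_eq {n : ℕ} (x : Cl n) : ‖x‖ ^ 2 = ∑ A, coeff A x ^ 2 := by
  rw [← real_inner_self_eq_norm_sq]
  exact Finset.sum_congr rfl fun A _ => (sq (coeff A x)).symm

/-- The paravectors `x₀ + ∑ xᵢ eᵢ`, a copy of `ℝ^{n+1}` inside `ℝ_n`. -/
def paravectors (n : ℕ) : Submodule ℝ (Cl n) :=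
  Submodule.span ℝ (insert 1 (range (e : Fin n → Cl n)))

/-! ### Clifford-valued Lebesgue and Sobolev spaces -/

/-- `ℝⁿ` with its Euclidean structure and Lebesgue measure. -/
abbrev E (n : ℕ) : Type := EuclideanSpace ℝ (Fin n)

/-- The index of the last coordinate `y = x_n`. -/
def lastIdx {n : ℕ} (hn : 2 ≤ n) : Fin n := ⟨n - 1, by omega⟩

/-- `L²(Ω, ℝ_n)`. -/
abbrev L2 {n : ℕ} (Ω : Set (E n)) : Type := Lp (Cl n) 2 (volume.restrict Ω)

/-- The Clifford-valued product `⟨F, G⟩₂ = ∫_Ω conj(F) G dx`; `star` is the Clifford conjugation,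
the anti-automorphism with `star eᵢ = -eᵢ`. -/
def inner2 {n : ℕ} (Ω : Set (E n)) (F G : E n → Cl n) : Cl n := ∫ p in Ω, star (F p) * G p

/-- The classical `j`-th partial derivative. -/
def partialDeriv {n : ℕ} {V : Type*} [NormedAddCommGroup V] [NormedSpace ℝ V] (j : Fin n)
    (φ : E n → V) (p : E n) : V := fderiv ℝ φ p (EuclideanSpace.single j 1)

/-- `φ ∈ C_c^∞(Ω, V)`. -/
structure IsTest {n : ℕ} {V : Type*} [NormedAddCommGroup V] [NormedSpace ℝ V] (Ω : Set (E n))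
    (φ : E n → V) : Prop where
  smooth : ContDiff ℝ ∞ φ
  compact : HasCompactSupport φ
  support : tsupport φ ⊆ Ω

/-- `G ∈ L²` is the `j`-th weak derivative of `F ∈ L²` on `Ω`. -/
def IsWeakDeriv {n : ℕ} {Ω : Set (E n)} (j : Fin n) (F G : L2 Ω) : Prop :=
  ∀ φ : E n → ℝ, IsTest Ω φ →
    ∫ p in Ω, partialDeriv j φ p • F p = -∫ p in Ω, φ p • G p

/-- `H¹(Ω, ℝ_n)`: all first-order weak derivatives exist in `L²`. -/
def H1 {n : ℕ} (Ω : Set (E n)) : Set (L2 Ω) := {F | ∀ j, ∃ G, IsWeakDeriv j F G}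

open Classical in
/-- The `j`-th weak derivative of `F` (meaningful for `F ∈ H¹`). -/
def weakDeriv {n : ℕ} {Ω : Set (E n)} (j : Fin n) (F : L2 Ω) : L2 Ω :=
  if h : ∃ G, IsWeakDeriv j F G then h.choose else 0

/-- The Dirichlet seminorm `‖F‖_D = (∑ⱼ ‖∂ⱼF‖₂²)^{1/2}`. -/
def normD {n : ℕ} {Ω : Set (E n)} (F : L2 Ω) : ℝ := √(∑ j, ‖weakDeriv j F‖ ^ 2)

/-- The Sobolev norm `‖F‖_{H¹} = (‖F‖₂² + ‖F‖_D²)^{1/2}`. -/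
def normH1 {n : ℕ} {Ω : Set (E n)} (F : L2 Ω) : ℝ := √(‖F‖ ^ 2 + normD F ^ 2)

/-- `H¹₀(Ω, ℝ_n)`: the closure of `C_c^∞(Ω, ℝ_n)` in `H¹(Ω, ℝ_n)`. -/
def H10 {n : ℕ} (Ω : Set (E n)) : Set (L2 Ω) :=
  {F | F ∈ H1 Ω ∧ ∀ ε > 0, ∃ (φ : E n → Cl n) (Φ : L2 Ω),
    IsTest Ω φ ∧ Φ =ᵐ[volume.restrict Ω] φ ∧ normH1 (F - Φ) < ε}

/-! ### The hyperbolic Dirac operator and the weak Dirichlet problem -/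

/-- `α_n = (n - 1) / 2`. -/
def alpha (n : ℕ) : ℝ := ((n : ℝ) - 1) / 2

/-- `β_n = α_n + α_n²`. -/
def beta (n : ℕ) : ℝ := alpha n + alpha n ^ 2

/-- The hyperbolic Dirac operator `D_H F = ∑_{i<n} eᵢ y ∂_{xᵢ} F - α_n e_n F + e_n y ∂_y F`, with
`y = x_n`, so that the two derivative terms form one sum over all coordinates. -/
def diracH {n : ℕ} (hn : 2 ≤ n) {Ω : Set (E n)} (F : L2 Ω) (p : E n) : Cl n :=
  ∑ j : Fin n, e j * (p (lastIdx hn) • weakDeriv j F p) - alpha n • (e (lastIdx hn) * F p)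

/-- The form `q_s` of `Q_s(D_H) = D_H² - 2 s₀ D_H + |s|²` with Dirichlet conditions; the terms
`⟨y² ∂_{xᵢ}F, ∂_{xᵢ}G⟩₂`, `i < n`, and `⟨y² ∂_yF, ∂_yG⟩₂` are collected in one sum. -/
def formQ {n : ℕ} (hn : 2 ≤ n) (Ω : Set (E n)) (s : Cl n) (F G : L2 Ω) : Cl n :=
  ∑ j : Fin n, inner2 Ω (fun p => p (lastIdx hn) ^ 2 • weakDeriv j F p) (weakDeriv j G)
    + (2 * (1 + alpha n)) •
        inner2 Ω (fun p => p (lastIdx hn) • weakDeriv (lastIdx hn) F p) G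
    + inner2 Ω (fun p => (e (lastIdx hn) - algebraMap ℝ (Cl n) (2 * Sc s)) * diracH hn F p) G
    + inner2 Ω (fun p => (‖s‖ ^ 2 - beta n) • F p) G

/-- `F ∈ H¹₀` is a weak solution of `Q_s(D_H) F = f` with homogeneous Dirichlet conditions. -/
def IsWeakSol {n : ℕ} (hn : 2 ≤ n) (Ω : Set (E n)) (s : Cl n) (f F : L2 Ω) : Prop :=
  F ∈ H10 Ω ∧ ∀ G ∈ H10 Ω, formQ hn Ω s F G = inner2 Ω f G

/-- The constant `K_{n,m,M}(s)`. -/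
def K (n : ℕ) (m M : ℝ) (s : Cl n) : ℝ :=
  1 / 2 * |‖s‖ ^ 2 - beta n| - 1 / 2 * (alpha n * √(1 + 4 * Sc s ^ 2)) + 1 / 2 * m ^ 2
    - 1 / 2 * √((|‖s‖ ^ 2 - beta n| - alpha n * √(1 + 4 * Sc s ^ 2) - m ^ 2) ^ 2
        + M ^ 2 * (2 * (1 + alpha n) + √n * √(1 + 4 * Sc s ^ 2)) ^ 2)

end HypDirac

end

noncomputable section

namespace HypDirac

/-! ### Left multiplication and the Euclidean scalar product -/

/-! The scalar part of `q_s` is a real bilinear form to which Lax–Milgram applies. Write d = ‖F‖_D,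
u = ‖F‖₂ and r = √(1 + 4s₀²). Since m ≤ y ≤ M on Ω, estimating each term by Cauchy–Schwarz gives Sc
q_s(F,F) ≥ m²d² - M(2(1+α) + √n r) d u + (|s|² - β - αr) u². The hypotheses force |s|² > β, and `K`
is then the smallest eigenvalue of this binary quadratic form (`min_eigenvalue_le`). Hence Sc
q_s(F,F) ≥ K(u² + d²), which is `K_mul_norm_sq_le`. The two inequalities assumed on s say that the
trace and the determinant are positive, so K > 0 (`K_pos`).

The Hilbert space is the closure, in a product of copies of L², of the tuples (φ, ∂₁φ, …, ∂ₙφ) with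
φ a test function; weak derivatives are unique, so it is a copy of H¹₀. The form is continuous
there, and testing the solution against itself gives K‖U‖² ≤ ‖f‖‖U‖, hence both norm bounds.

Lax–Milgram solves only the scalar part of the equation. Since H¹₀ is stable under right
multiplication by Clifford numbers and both sides are right linear in G, the full equation follows
(`isWeakSol_iff`). -/

theorem e_mul_eA {n : ℕ} (i : Fin n) (A : Finset (Fin n)) :
    (e i : Cl n) * eA A = eA (symmDiff {i} A) ∨ (e i : Cl n) * eA A = -eA (symmDiff {i} A) := by
  induction A using Finset.induction_on_min with
  | empty =>
    left
    have h : symmDiff {i} (∅ : Finset (Fin n)) = insert i ∅ := by ext x; simp [Finset.mem_symmDiff]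
    rw [h, eA_insert (by simp)]
  | insert a A ha ih =>
    rcases lt_trichotomy i a with h | h | h
    · left
      have hlt : ∀ b ∈ insert a A, i < b := by
        intro b hb
        rcases Finset.mem_insert.1 hb with rfl | hb
        · exact h
        · exact h.trans (ha b hb)
      have h : symmDiff {i} (insert a A) = insert i (insert a A) := by
        ext x
        simp only [Finset.mem_symmDiff, Finset.mem_singleton]
        have := fun hx => (hlt x hx).ne'
        rw [Finset.mem_insert (s := insert a A)]
        tauto
      rw [h, eA_insert hlt]
    · subst h
      right
      have h : symmDiff {i} (insert i A) = A := by
        ext x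
        simp only [Finset.mem_symmDiff, Finset.mem_singleton, Finset.mem_insert]
        have := fun hx => (ha x hx).ne'
        tauto
      rw [h, eA_insert ha, ← mul_assoc, e_mul_self, neg_one_mul]
    · have hs : symmDiff {i} (insert a A) = insert a (symmDiff {i} A) := by
        ext x
        simp only [Finset.mem_symmDiff, Finset.mem_singleton, Finset.mem_insert]
        by_cases hx : x = a
        · subst hx; simp [h.ne]
        · simp [hx]
      have hlt : ∀ b ∈ symmDiff {i} A, a < b := by
        intro b hb
        simp only [Finset.mem_symmDiff, Finset.mem_singleton] at hb
        rcases hb with ⟨rfl, -⟩ | ⟨hb, -⟩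
        · exact h
        · exact ha b hb
      rw [hs, eA_insert hlt, eA_insert ha, ← mul_assoc, e_mul_e h.ne', neg_mul, mul_assoc]
      rcases ih with ih | ih <;> rw [ih] <;> simp

theorem inner_eq {n : ℕ} (x y : Cl n) : inner ℝ x y = ∑ A, coeff A x * coeff A y := rfl

theorem coeff_eA {n : ℕ} (A B : Finset (Fin n)) : coeff A (eA B) = if B = A then 1 else 0 := by
  rw [coeff, ← clBasis_apply, Module.Basis.repr_self, Finsupp.single_apply]

theorem inner_eA {n : ℕ} (A B : Finset (Fin n)) :
    inner ℝ (eA A : Cl n) (eA B) = if A = B then 1 else 0 := by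
  simp [inner_eq, coeff_eA]

/-- Left multiplication by a generator permutes the orthonormal basis `eA` up to signs, so it is an
isometry. -/
theorem inner_e_mul_e_mul {n : ℕ} (i : Fin n) (x y : Cl n) :
    inner ℝ (e i * x) (e i * y) = inner ℝ x y := by
  have h : ((innerₗ (Cl n)).compl₁₂ (LinearMap.mulLeft ℝ (e i)) (LinearMap.mulLeft ℝ (e i))) =
      innerₗ (Cl n) := by
    refine (clBasis n).ext fun A => (clBasis n).ext fun B => ?_
    simp only [LinearMap.compl₁₂_apply, LinearMap.mulLeft_apply, innerₗ_apply_apply, clBasis_apply]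
    rcases e_mul_eA i A with hA | hA <;> rcases e_mul_eA i B with hB | hB <;> rw [hA, hB]
    · simp only [inner_eA, symmDiff_right_inj]
    · rcases eq_or_ne A B with rfl | hAB
      -- Opposite signs for the same basis vector would make a basis vector equal to its negative,
      -- hence zero.
      · have := hA.symm.trans hB
        rw [eq_neg_iff_add_eq_zero, ← two_smul ℝ, smul_eq_zero] at this
        simp [← clBasis_apply, (clBasis n).ne_zero] at this
      · simp [inner_neg_right, inner_eA, hAB]
    · rcases eq_or_ne A B with rfl | hAB
      · have := hB.symm.trans hA
        rw [eq_neg_iff_add_eq_zero, ← two_smul ℝ, smul_eq_zero] at this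
        simp [← clBasis_apply, (clBasis n).ne_zero] at this
      · simp [inner_neg_left, inner_eA, hAB]
    · simp only [inner_neg_left, inner_neg_right, neg_neg, inner_eA, symmDiff_right_inj]
  simpa using LinearMap.congr_fun (LinearMap.congr_fun h x) y

theorem norm_e_mul {n : ℕ} (i : Fin n) (x : Cl n) : ‖e i * x‖ = ‖x‖ := by
  rw [norm_eq_sqrt_real_inner, inner_e_mul_e_mul, ← norm_eq_sqrt_real_inner]

theorem inner_e_mul_left {n : ℕ} (i : Fin n) (x y : Cl n) :
    inner ℝ (e i * x) y = -inner ℝ x (e i * y) := by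
  rw [← inner_e_mul_e_mul i (e i * x)]
  simp [← mul_assoc, e_mul_self]

/-- Each generator acts skew-adjointly, being an isometry of square -1. Since conjugation reverses
products, the adjoint rule passes from generators to the whole algebra. -/
theorem inner_mul_left_eq {n : ℕ} (a x y : Cl n) :
    inner ℝ (a * x) y = inner ℝ x (star a * y) := by
  induction a using CliffordAlgebra.left_induction generalizing x y with
  | algebraMap r =>
    simp only [CliffordAlgebra.star_algebraMap, ← Algebra.smul_def]
    rw [real_inner_smul_left, real_inner_smul_right]
  | add a b ha hb => rw [add_mul, inner_add_left, ha, hb, star_add, add_mul, inner_add_right]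
  | ι_mul a m ha =>
    have hm : CliffordAlgebra.ι (quadForm n) m = ∑ i, m i • (e i : Cl n) := by
      simp only [e, ← map_smul, ← map_sum]
      congr 1
      ext j
      simp [Finset.sum_apply, Pi.single_apply]
    have key : ∀ x y : Cl n, inner ℝ (CliffordAlgebra.ι (quadForm n) m * x) y =
        inner ℝ x (star (CliffordAlgebra.ι (quadForm n) m) * y) := by
      intro x y
      rw [CliffordAlgebra.star_ι, hm, Finset.sum_mul, sum_inner, neg_mul, inner_neg_right,
        Finset.sum_mul, inner_sum, ← Finset.sum_neg_distrib]
      refine Finset.sum_congr rfl fun i _ => ?_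
      rw [smul_mul_assoc, smul_mul_assoc, real_inner_smul_left, real_inner_smul_right,
        inner_e_mul_left, mul_neg]
    rw [mul_assoc, key, ha, star_mul, mul_assoc]

theorem Sc_eq_inner {n : ℕ} (x : Cl n) : Sc x = inner ℝ 1 x := by
  simp [inner_eq, ← eA_empty, coeff_eA, Sc]

theorem Sc_star_mul {n : ℕ} (x y : Cl n) : Sc (star x * y) = inner ℝ x y := by
  rw [Sc_eq_inner, ← inner_mul_left_eq, mul_one]

/-- The choice a = x̄ gives Sc(x x̄) = |x̄|². This lets scalar identities recover Clifford-valued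
ones. -/
theorem eq_zero_of_forall_Sc_mul {n : ℕ} {x : Cl n} (h : ∀ a, Sc (x * a) = 0) : x = 0 := by
  have := h (star x)
  rw [← star_star x, star_star (star x), Sc_star_mul, inner_self_eq_zero] at this
  simpa using this

instance (n : ℕ) : FiniteDimensional ℝ (Cl n) := (clBasis n).finiteDimensional_of_finite

/-- By skew-adjointness `e i * x` is orthogonal to `x`, so Pythagoras applies. With t = 2s₀ this is
the source of the factor √(1 + 4s₀²). -/
theorem norm_e_sub_algebraMap_mul {n : ℕ} (i : Fin n) (t : ℝ) (x : Cl n) :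
    ‖(e i - algebraMap ℝ (Cl n) t) * x‖ = √(1 + t ^ 2) * ‖x‖ := by
  have h : inner ℝ (e i * x) x = 0 := by
    have := inner_e_mul_left i x x
    rw [real_inner_comm] at this ⊢
    linarith
  rw [← sq_eq_sq₀ (norm_nonneg _) (by positivity), mul_pow, Real.sq_sqrt (by positivity),
    sub_mul, ← Algebra.smul_def, norm_sub_sq_real, norm_e_mul, real_inner_smul_right, h, norm_smul,
    Real.norm_eq_abs, mul_pow, sq_abs]
  ring

/-! ### Bounded operators on `L²(Ω, ℝ_n)` -/

/-- The product `(x, y) ↦ x̄ y` as a bounded bilinear map. -/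
def starMulL (n : ℕ) : Cl n →L[ℝ] Cl n →L[ℝ] Cl n :=
  (LinearMap.mk₂ ℝ (fun x y : Cl n => star x * y)
    (fun x y z => by simp [add_mul]) (fun c x y => by rw [CliffordAlgebra.star_smul, smul_mul_assoc])
    (fun x y z => mul_add _ _ _) (fun c x y => mul_smul_comm _ _ _)).toContinuousBilinearMap

/-- The scalar part as a bounded functional. -/
def ScL (n : ℕ) : Cl n →L[ℝ] ℝ := ((clBasis n).coord ∅).toContinuousLinearMap

theorem ScL_apply {n : ℕ} (x : Cl n) : ScL n x = Sc x := rfl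

/-- Right multiplication by `a` as a bounded operator. -/
def mulRightL {n : ℕ} (a : Cl n) : Cl n →L[ℝ] Cl n :=
  (LinearMap.mulRight ℝ a).toContinuousLinearMap

theorem mulRightL_apply {n : ℕ} (a x : Cl n) : mulRightL a x = x * a := rfl

variable {n : ℕ} {Ω : Set (E n)}

/-- Pointwise left multiplication by `a` on `L²`. -/
def lmul (Ω : Set (E n)) (a : Cl n) : L2 Ω →L[ℝ] L2 Ω :=
  ContinuousLinearMap.compLpL 2 (volume.restrict Ω) (LinearMap.mulLeft ℝ a).toContinuousLinearMap

theorem lmul_ae (a : Cl n) (F : L2 Ω) : lmul Ω a F =ᵐ[volume.restrict Ω] fun p => a * F p :=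
  ContinuousLinearMap.coeFn_compLpL _ F

/-- Pointwise right multiplication by `a` on `L²`. -/
def rmul (Ω : Set (E n)) (a : Cl n) : L2 Ω →L[ℝ] L2 Ω :=
  ContinuousLinearMap.compLpL 2 (volume.restrict Ω) (mulRightL a)

theorem rmul_ae (a : Cl n) (F : L2 Ω) : rmul Ω a F =ᵐ[volume.restrict Ω] fun p => F p * a :=
  ContinuousLinearMap.coeFn_compLpL _ F

/-- Pointwise multiplication by a bounded function on `L²`. -/
def mulFun {g : E n → ℝ} (hg : MemLp g ⊤ (volume.restrict Ω)) : L2 Ω →L[ℝ] L2 Ω :=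
  (ContinuousLinearMap.lsmul ℝ ℝ).holderL (volume.restrict Ω) ⊤ 2 2 hg.toLp

theorem mulFun_ae {g : E n → ℝ} (hg : MemLp g ⊤ (volume.restrict Ω)) (F : L2 Ω) :
    mulFun hg F =ᵐ[volume.restrict Ω] fun p => g p • F p := by
  filter_upwards [(ContinuousLinearMap.lsmul ℝ ℝ).coeFn_holder (r := 2) hg.toLp F,
    hg.coeFn_toLp] with p h1 h2
  exact h1.trans (by rw [h2]; rfl)

/-- The `ℝ_n`-valued product of `L²(Ω, ℝ_n)` as a bounded bilinear map. -/
def pairing (Ω : Set (E n)) : L2 Ω →L[ℝ] L2 Ω →L[ℝ] Cl n :=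
  (starMulL n).lpPairing (volume.restrict Ω) 2 2

theorem pairing_apply (F G : L2 Ω) : pairing Ω F G = inner2 Ω F G :=
  (starMulL n).lpPairing_eq_integral F G

theorem inner2_congr {F F' G G' : E n → Cl n} (hF : F =ᵐ[volume.restrict Ω] F')
    (hG : G =ᵐ[volume.restrict Ω] G') : inner2 Ω F G = inner2 Ω F' G' := by
  refine integral_congr_ae ?_
  filter_upwards [hF, hG] with p h1 h2
  rw [h1, h2]

theorem integrable_star_mul (F G : L2 Ω) :
    Integrable (fun p => star (F p) * G p) (volume.restrict Ω) :=
  memLp_one_iff_integrable.1 ((starMulL n).memLp_of_bilin 1 (Lp.memLp F) (Lp.memLp G))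

theorem Sc_pairing (F G : L2 Ω) : Sc (pairing Ω F G) = inner ℝ F G := by
  rw [pairing_apply, inner2, ← ScL_apply, ← (ScL n).integral_comp_comm (integrable_star_mul F G),
    L2.inner_def]
  simp only [ScL_apply, Sc_star_mul]

theorem pairing_rmul (a : Cl n) (F G : L2 Ω) :
    pairing Ω F (rmul Ω a G) = pairing Ω F G * a := by
  rw [pairing_apply, pairing_apply, inner2_congr Filter.EventuallyEq.rfl (rmul_ae a G), inner2,
    inner2, ← mulRightL_apply, ← (mulRightL a).integral_comp_comm (integrable_star_mul F G)]
  simp only [mulRightL_apply, mul_assoc]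

theorem norm_lmul_e (i : Fin n) (F : L2 Ω) : ‖lmul Ω (e i) F‖ ≤ ‖F‖ := by
  refine Lp.norm_le_norm_of_ae_le ?_
  filter_upwards [lmul_ae (e i) F] with p hp
  rw [hp, norm_e_mul]

theorem norm_lmul_e_sub (i : Fin n) (t : ℝ) (F : L2 Ω) :
    ‖lmul Ω (e i - algebraMap ℝ (Cl n) t) F‖ ≤ √(1 + t ^ 2) * ‖F‖ := by
  refine Lp.norm_le_mul_norm_of_ae_le_mul ?_
  filter_upwards [lmul_ae (e i - algebraMap ℝ (Cl n) t) F] with p hp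
  rw [hp, norm_e_sub_algebraMap_mul]

theorem norm_mulFun_le {g : E n → ℝ} (hg : MemLp g ⊤ (volume.restrict Ω)) {M : ℝ}
    (hM : ∀ᵐ p ∂volume.restrict Ω, |g p| ≤ M) (F : L2 Ω) : ‖mulFun hg F‖ ≤ M * ‖F‖ := by
  refine Lp.norm_le_mul_norm_of_ae_le_mul ?_
  filter_upwards [mulFun_ae hg F, hM] with p hp h
  rw [hp, norm_smul, Real.norm_eq_abs]
  gcongr

theorem le_norm_mulFun {g : E n → ℝ} (hg : MemLp g ⊤ (volume.restrict Ω)) {m : ℝ} (hm : 0 < m)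
    (h : ∀ᵐ p ∂volume.restrict Ω, m ≤ |g p|) (F : L2 Ω) : m * ‖F‖ ≤ ‖mulFun hg F‖ := by
  have : ‖F‖ ≤ m⁻¹ * ‖mulFun hg F‖ := by
    refine Lp.norm_le_mul_norm_of_ae_le_mul ?_
    filter_upwards [mulFun_ae hg F, h] with p hp h
    rw [hp, norm_smul, Real.norm_eq_abs, ← div_eq_inv_mul, le_div_iff₀ hm, mul_comm]
    gcongr
  rwa [← div_eq_inv_mul, le_div_iff₀ hm, mul_comm] at this

theorem inner_mulFun_left {g : E n → ℝ} (hg : MemLp g ⊤ (volume.restrict Ω)) (F G : L2 Ω) :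
    inner ℝ (mulFun hg F) G = inner ℝ F (mulFun hg G) := by
  rw [L2.inner_def, L2.inner_def]
  refine integral_congr_ae ?_
  filter_upwards [mulFun_ae hg F, mulFun_ae hg G] with p h1 h2
  rw [h1, h2, real_inner_smul_left, real_inner_smul_right]

/-! ### Test functions and weak derivatives -/

section Test

variable {V W : Type*} [NormedAddCommGroup V] [NormedSpace ℝ V] [NormedAddCommGroup W]
  [NormedSpace ℝ W]

theorem IsTest.partialDeriv {φ : E n → V} (h : IsTest Ω φ) (j : Fin n) :
    IsTest Ω (partialDeriv j φ) where
  smooth := (h.smooth.fderiv_right (m := ∞) (by simp)).clm_apply contDiff_const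
  compact := h.compact.fderiv_apply ℝ _
  support := (tsupport_fderiv_apply_subset ℝ _).trans h.support

theorem IsTest.eq_zero {φ : E n → V} (h : IsTest Ω φ) {p : E n} (hp : p ∉ Ω) : φ p = 0 :=
  image_eq_zero_of_notMem_tsupport fun hp' => hp (h.support hp')

theorem IsTest.memLp {φ : E n → V} (h : IsTest Ω φ) : MemLp φ 2 (volume.restrict Ω) :=
  h.smooth.continuous.memLp_of_hasCompactSupport h.compact

theorem IsTest.zero : IsTest Ω (fun _ => 0 : E n → V) where
  smooth := contDiff_const
  compact := HasCompactSupport.zero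
  support := by simp [tsupport]

theorem IsTest.add {φ ψ : E n → V} (h : IsTest Ω φ) (h' : IsTest Ω ψ) :
    IsTest Ω (fun p => φ p + ψ p) where
  smooth := h.smooth.add h'.smooth
  compact := h.compact.add h'.compact
  support := (tsupport_add φ ψ).trans (union_subset h.support h'.support)

theorem IsTest.clm_comp {φ : E n → V} (h : IsTest Ω φ) (L : V →L[ℝ] W) :
    IsTest Ω (fun p => L (φ p)) where
  smooth := L.contDiff.comp h.smooth
  compact := h.compact.comp_left (g := L) L.map_zero
  support := (tsupport_comp_subset L.map_zero φ).trans h.support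

theorem IsTest.partialDeriv_add {φ ψ : E n → V} (h : IsTest Ω φ) (h' : IsTest Ω ψ) (j : Fin n)
    (p : E n) : HypDirac.partialDeriv j (fun p => φ p + ψ p) p =
      HypDirac.partialDeriv j φ p + HypDirac.partialDeriv j ψ p := by
  rw [HypDirac.partialDeriv, fderiv_fun_add (h.smooth.differentiable (by simp) p)
    (h'.smooth.differentiable (by simp) p)]
  rfl

theorem IsTest.partialDeriv_clm_comp {φ : E n → V} (h : IsTest Ω φ) (L : V →L[ℝ] W) (j : Fin n)
    (p : E n) : HypDirac.partialDeriv j (fun p => L (φ p)) p =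
      L (HypDirac.partialDeriv j φ p) := by
  have := (L.hasFDerivAt.comp p (h.smooth.differentiable (by simp) p).hasFDerivAt).fderiv
  rw [HypDirac.partialDeriv]
  change fderiv ℝ (L ∘ φ) p _ = _
  rw [this]
  rfl

theorem IsTest.integral_by_parts {ψ : E n → ℝ} {φ : E n → V} (hψ : IsTest Ω ψ)
    (hφ : IsTest Ω φ) (j : Fin n) :
    ∫ p in Ω, HypDirac.partialDeriv j ψ p • φ p =
      -∫ p in Ω, ψ p • HypDirac.partialDeriv j φ p := by
  have hint : ∀ {a : E n → ℝ} {b : E n → V}, IsTest Ω a → IsTest Ω b →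
      Integrable (fun p => a p • b p) := fun ha hb =>
    (ha.smooth.continuous.smul hb.smooth.continuous).integrable_of_hasCompactSupport
      (ha.compact.smul_right)
  -- Both integrands vanish off Ω, so integration by parts takes place on the whole space, with no
  -- boundary term.
  rw [setIntegral_eq_integral_of_forall_compl_eq_zero fun p hp => by rw [hφ.eq_zero hp, smul_zero],
    setIntegral_eq_integral_of_forall_compl_eq_zero fun p hp => by rw [hψ.eq_zero hp, zero_smul],
    eq_neg_iff_add_eq_zero, add_comm, ← eq_neg_iff_add_eq_zero]
  exact integral_smul_fderiv_eq_neg_fderiv_smul_of_integrable (hint (hψ.partialDeriv j) hφ)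
    (hint hψ (hφ.partialDeriv j)) (hint hψ hφ)
    (fun p _ => hψ.smooth.differentiable (by simp) p)
    (fun p _ => hφ.smooth.differentiable (by simp) p)

end Test

/-- Integration of `F ∈ L²(Ω, ℝ_n)` against a real test function. -/
def testPairing {φ : E n → ℝ} (hφ : IsTest Ω φ) : L2 Ω →L[ℝ] Cl n :=
  (ContinuousLinearMap.lsmul ℝ ℝ).lpPairing (volume.restrict Ω) 2 2 hφ.memLp.toLp

theorem testPairing_apply {φ : E n → ℝ} (hφ : IsTest Ω φ) (F : L2 Ω) :
    testPairing hφ F = ∫ p in Ω, φ p • F p := by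
  rw [testPairing, ContinuousLinearMap.lpPairing_eq_integral]
  refine integral_congr_ae ?_
  filter_upwards [hφ.memLp.coeFn_toLp] with p hp
  rw [hp]
  rfl

/-- Written with bounded operators on L², the condition is visibly linear and closed under L²
limits. -/
theorem isWeakDeriv_iff {j : Fin n} {F G : L2 Ω} : IsWeakDeriv j F G ↔
    ∀ (φ : E n → ℝ) (hφ : IsTest Ω φ),
      testPairing (hφ.partialDeriv j) F = -testPairing hφ G := by
  simp only [testPairing_apply]
  rfl

theorem IsWeakDeriv.sub {j : Fin n} {F F' G G' : L2 Ω} (h : IsWeakDeriv j F G)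
    (h' : IsWeakDeriv j F' G') : IsWeakDeriv j (F - F') (G - G') := by
  rw [isWeakDeriv_iff] at *
  intro φ hφ
  rw [map_sub, map_sub, h φ hφ, h' φ hφ]
  abel

/-- An L² function is integrable on compact subsets of Ω, so the fundamental lemma of the calculus
of variations applies. The arbitrary choice in `weakDeriv` is therefore harmless. -/
theorem IsWeakDeriv.unique (hΩ : IsOpen Ω) {j : Fin n} {F G G' : L2 Ω} (h : IsWeakDeriv j F G)
    (h' : IsWeakDeriv j F G') : G = G' := by
  rw [← sub_eq_zero]
  have h0 := h.sub h'
  rw [sub_self, isWeakDeriv_iff] at h0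
  refine Lp.ext ?_
  have hloc : LocallyIntegrableOn (G - G' : L2 Ω) Ω volume := by
    rw [locallyIntegrableOn_iff hΩ.isLocallyClosed]
    intro k hk hkc
    have h1 : MemLp (G - G' : L2 Ω) 2 (volume.restrict k) :=
      (Lp.memLp (G - G')).mono_measure (Measure.restrict_mono hk le_rfl)
    have : IsFiniteMeasure (volume.restrict k) := ⟨by simpa using hkc.measure_lt_top⟩
    exact h1.integrable (by norm_num)
  have := hΩ.ae_eq_zero_of_integral_contDiff_smul_eq_zero hloc fun g h1 h2 h3 => by
    have hg : IsTest Ω g := ⟨h1, h2, h3⟩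
    have := h0 g hg
    rw [map_zero, testPairing_apply, eq_comm, neg_eq_zero] at this
    rwa [setIntegral_eq_integral_of_forall_compl_eq_zero fun p hp => by
      rw [hg.eq_zero hp, zero_smul]] at this
  filter_upwards [(ae_restrict_iff' hΩ.measurableSet).2 this,
    Lp.coeFn_zero (Cl n) 2 (volume.restrict Ω)] with p h1 h2
  rw [h1, h2]
  rfl

theorem weakDeriv_eq (hΩ : IsOpen Ω) {j : Fin n} {F G : L2 Ω} (h : IsWeakDeriv j F G) :
    weakDeriv j F = G := by
  have hex : ∃ G, IsWeakDeriv j F G := ⟨G, h⟩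
  rw [weakDeriv, dif_pos hex]
  exact hex.choose_spec.unique hΩ h

theorem isWeakDeriv_weakDeriv {F : L2 Ω} (h : F ∈ H1 Ω) (j : Fin n) :
    IsWeakDeriv j F (weakDeriv j F) := by
  rw [weakDeriv, dif_pos (h j)]
  exact (h j).choose_spec

/-! ### `H¹₀` as a Hilbert space of tuples `(F, ∂₁F, …, ∂ₙF)` -/

/-- Tuples of one `L²` function (at `none`) and `n` candidates for its derivatives. -/
abbrev Jet (Ω : Set (E n)) : Type := PiLp 2 (fun _ : Option (Fin n) => L2 Ω)

theorem Jet.norm_sq (U : Jet Ω) : ‖U‖ ^ 2 = ‖U none‖ ^ 2 + ∑ j, ‖U (some j)‖ ^ 2 := by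
  rw [PiLp.norm_sq_eq_of_L2, Fintype.sum_option]

/-- `U` is the tuple of the test function `φ` and its partial derivatives. -/
structure IsTestJet (φ : E n → Cl n) (U : Jet Ω) : Prop where
  isTest : IsTest Ω φ
  fn : U none =ᵐ[volume.restrict Ω] φ
  deriv : ∀ j, U (some j) =ᵐ[volume.restrict Ω] partialDeriv j φ

/-- The tuples `(φ, ∂₁φ, …, ∂ₙφ)` of test functions `φ`. -/
def testJets (Ω : Set (E n)) : Submodule ℝ (Jet Ω) where
  carrier := {U | ∃ φ, IsTestJet φ U}
  zero_mem' := by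
    refine ⟨fun _ => 0, IsTest.zero, Lp.coeFn_zero _ _ _, fun j => ?_⟩
    filter_upwards [Lp.coeFn_zero (Cl n) 2 (volume.restrict Ω)] with p hp
    simpa [partialDeriv] using hp
  add_mem' := by
    rintro U W ⟨φ, hφ⟩ ⟨ψ, hψ⟩
    refine ⟨fun p => φ p + ψ p, hφ.isTest.add hψ.isTest, ?_, fun j => ?_⟩
    · filter_upwards [hφ.fn, hψ.fn, Lp.coeFn_add (U none) (W none)] with p h1 h2 h3
      rw [← h1, ← h2]
      exact h3
    · filter_upwards [hφ.deriv j, hψ.deriv j, Lp.coeFn_add (U (some j)) (W (some j))]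
        with p h1 h2 h3
      rw [hφ.isTest.partialDeriv_add hψ.isTest, ← h1, ← h2]
      exact h3
  smul_mem' := by
    rintro c U ⟨φ, hφ⟩
    refine ⟨fun p => (c • ContinuousLinearMap.id ℝ (Cl n)) (φ p), hφ.isTest.clm_comp _, ?_,
      fun j => ?_⟩
    · filter_upwards [hφ.fn, Lp.coeFn_smul c (U none)] with p h1 h2
      rw [← h1]
      exact h2
    · filter_upwards [hφ.deriv j, Lp.coeFn_smul c (U (some j))] with p h1 h2
      rw [hφ.isTest.partialDeriv_clm_comp, ← h1]
      exact h2

/-- The closure of the tuples `(φ, ∂₁φ, …, ∂ₙφ)`. -/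
def sobolevJets (Ω : Set (E n)) : Submodule ℝ (Jet Ω) := (testJets Ω).topologicalClosure

instance : CompleteSpace (sobolevJets Ω) :=
  (testJets Ω).isClosed_topologicalClosure.completeSpace_coe

theorem IsTestJet.isWeakDeriv {φ : E n → Cl n} {U : Jet Ω} (h : IsTestJet φ U) (j : Fin n) :
    IsWeakDeriv j (U none) (U (some j)) := by
  intro ψ hψ
  rw [integral_congr_ae (g := fun p => partialDeriv j ψ p • φ p), hψ.integral_by_parts h.isTest,
    integral_congr_ae (f := fun p => ψ p • U (some j) p)]
  · filter_upwards [h.deriv j] with p hp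
    rw [hp]
  · filter_upwards [h.fn] with p hp
    rw [hp]

theorem exists_isTestJet {φ : E n → Cl n} (hφ : IsTest Ω φ) : ∃ U : Jet Ω, IsTestJet φ U :=
  ⟨WithLp.toLp 2 fun i => i.elim hφ.memLp.toLp fun j => (hφ.partialDeriv j).memLp.toLp,
    hφ, hφ.memLp.coeFn_toLp, fun j => (hφ.partialDeriv j).memLp.coeFn_toLp⟩

theorem isWeakDeriv_of_mem_sobolevJets {U : Jet Ω} (hU : U ∈ sobolevJets Ω) (j : Fin n) :
    IsWeakDeriv j (U none) (U (some j)) := by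
  rw [isWeakDeriv_iff]
  intro φ hφ
  have hc : IsClosed {U : Jet Ω | testPairing (hφ.partialDeriv j) (U none) =
      -testPairing hφ (U (some j))} :=
    isClosed_eq (by fun_prop) (by fun_prop)
  refine closure_minimal ?_ hc hU
  rintro W ⟨ψ, hψ⟩
  exact isWeakDeriv_iff.1 (hψ.isWeakDeriv j) φ hφ

/-- The tuple `(F, ∂₁F, …, ∂ₙF)`. -/
def toJet (F : L2 Ω) : Jet Ω := WithLp.toLp 2 fun i => i.elim F fun j => weakDeriv j F

theorem toJet_none (F : L2 Ω) : toJet F none = F := rfl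

theorem toJet_some (F : L2 Ω) (j : Fin n) : toJet F (some j) = weakDeriv j F := rfl

theorem norm_toJet (F : L2 Ω) : ‖toJet F‖ = normH1 F := by
  rw [normH1, normD, Real.sq_sqrt (by positivity), ← Real.sqrt_sq (norm_nonneg (toJet F)),
    Jet.norm_sq]
  rfl

theorem toJet_eq (hΩ : IsOpen Ω) {U : Jet Ω}
    (h : ∀ j, IsWeakDeriv j (U none) (U (some j))) : toJet (U none) = U := by
  ext1 i
  cases i with
  | none => rfl
  | some j => exact weakDeriv_eq hΩ (h j)

/-- Together with `toJet_mem_sobolevJets` this identifies `H10 Ω` with `sobolevJets Ω`: `toJet`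
carries the Sobolev norm to the norm of the product, so approximation by test functions means the
same in both. -/
theorem mem_H10_of_mem_sobolevJets (hΩ : IsOpen Ω) {U : Jet Ω} (hU : U ∈ sobolevJets Ω) :
    U none ∈ H10 Ω := by
  refine ⟨fun j => ⟨_, isWeakDeriv_of_mem_sobolevJets hU j⟩, fun ε hε => ?_⟩
  obtain ⟨W, ⟨φ, hφ⟩, hW⟩ := Metric.mem_closure_iff.1 hU ε hε
  refine ⟨φ, W none, hφ.isTest, hφ.fn, ?_⟩
  rw [← norm_toJet, ← PiLp.sub_apply, toJet_eq hΩ fun j =>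
    (isWeakDeriv_of_mem_sobolevJets hU j).sub (hφ.isWeakDeriv j), ← dist_eq_norm]
  exact hW

theorem toJet_mem_sobolevJets (hΩ : IsOpen Ω) {F : L2 Ω} (hF : F ∈ H10 Ω) :
    toJet F ∈ sobolevJets Ω := by
  refine Metric.mem_closure_iff.2 fun ε hε => ?_
  obtain ⟨φ, Φ, hφ, hΦ, hlt⟩ := hF.2 ε hε
  obtain ⟨U, hU⟩ := exists_isTestJet hφ
  obtain rfl : Φ = U none := Lp.ext (hΦ.trans hU.fn.symm)
  refine ⟨U, ⟨φ, hU⟩, ?_⟩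
  have : toJet ((toJet F - U) none) = toJet F - U := toJet_eq hΩ fun j =>
    (isWeakDeriv_weakDeriv hF.1 j).sub (hU.isWeakDeriv j)
  rw [dist_eq_norm, ← this, norm_toJet]
  exact hlt

/-- Right multiplication of a tuple by a Clifford number. -/
def Jet.rmul (a : Cl n) (U : Jet Ω) : Jet Ω := WithLp.toLp 2 fun i => HypDirac.rmul Ω a (U i)

theorem Jet.rmul_apply (a : Cl n) (U : Jet Ω) (i : Option (Fin n)) :
    U.rmul a i = HypDirac.rmul Ω a (U i) := rfl

theorem rmul_mem_sobolevJets (a : Cl n) {U : Jet Ω} (hU : U ∈ sobolevJets Ω) :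
    U.rmul a ∈ sobolevJets Ω := by
  have hc : Continuous (Jet.rmul a : Jet Ω → Jet Ω) := by
    unfold Jet.rmul
    fun_prop
  refine map_mem_closure hc hU ?_
  rintro W ⟨φ, hφ⟩
  refine ⟨fun p => mulRightL a (φ p), hφ.isTest.clm_comp _, ?_, fun j => ?_⟩
  · filter_upwards [rmul_ae a (W none), hφ.fn] with p h1 h2
    rw [← h2]
    exact h1
  · filter_upwards [rmul_ae a (W (some j)), hφ.deriv j] with p h1 h2
    rw [hφ.isTest.partialDeriv_clm_comp, ← h2]
    exact h1

/-! ### The form on tuples -/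

/-- The `i`-th entry of a tuple. -/
def Jet.proj (Ω : Set (E n)) (i : Option (Fin n)) : Jet Ω →L[ℝ] L2 Ω :=
  PiLp.proj 2 (fun _ : Option (Fin n) => L2 Ω) i

theorem Jet.proj_apply (i : Option (Fin n)) (U : Jet Ω) : Jet.proj Ω i U = U i := rfl

section Form

variable (hn : 2 ≤ n) (hy : MemLp (fun p : E n => p (lastIdx hn)) ⊤ (volume.restrict Ω))

/-- The operator `D_H` on tuples. -/
def diracJet : Jet Ω →L[ℝ] L2 Ω :=
  ∑ j : Fin n, lmul Ω (e j) ∘L mulFun hy ∘L Jet.proj Ω (some j)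
    - alpha n • (lmul Ω (e (lastIdx hn)) ∘L Jet.proj Ω none)

theorem diracJet_apply (U : Jet Ω) : diracJet hn hy U =
    ∑ j : Fin n, lmul Ω (e j) (mulFun hy (U (some j)))
      - alpha n • lmul Ω (e (lastIdx hn)) (U none) := by
  simp [diracJet, Jet.proj_apply]

/-- The form `q_s` on tuples. -/
def formJet (s : Cl n) : Jet Ω →L[ℝ] Jet Ω →L[ℝ] Cl n :=
  ∑ j : Fin n, (pairing Ω).bilinearComp (mulFun hy ∘L mulFun hy ∘L Jet.proj Ω (some j))
      (Jet.proj Ω (some j))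
    + (2 * (1 + alpha n)) • (pairing Ω).bilinearComp
        (mulFun hy ∘L Jet.proj Ω (some (lastIdx hn))) (Jet.proj Ω none)
    + (pairing Ω).bilinearComp
        (lmul Ω (e (lastIdx hn) - algebraMap ℝ (Cl n) (2 * Sc s)) ∘L diracJet hn hy)
        (Jet.proj Ω none)
    + (pairing Ω).bilinearComp ((‖s‖ ^ 2 - beta n) • Jet.proj Ω none) (Jet.proj Ω none)

theorem formJet_apply (s : Cl n) (U W : Jet Ω) : formJet hn hy s U W =
    ∑ j : Fin n, pairing Ω (mulFun hy (mulFun hy (U (some j)))) (W (some j))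
    + (2 * (1 + alpha n)) • pairing Ω (mulFun hy (U (some (lastIdx hn)))) (W none)
    + pairing Ω (lmul Ω (e (lastIdx hn) - algebraMap ℝ (Cl n) (2 * Sc s)) (diracJet hn hy U))
        (W none)
    + pairing Ω ((‖s‖ ^ 2 - beta n) • U none) (W none) := by
  simp [formJet, Jet.proj_apply]

theorem formJet_rmul (s a : Cl n) (U W : Jet Ω) :
    formJet hn hy s U (W.rmul a) = formJet hn hy s U W * a := by
  simp only [formJet_apply, Jet.rmul_apply, pairing_rmul, add_mul, Finset.sum_mul, smul_mul_assoc]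

theorem diracJet_toJet (F : L2 Ω) :
    diracJet hn hy (toJet F) =ᵐ[volume.restrict Ω] diracH hn F := by
  rw [diracJet_apply]
  have h1 : ∀ᵐ p ∂volume.restrict Ω, ∀ j : Fin n,
      lmul Ω (e j) (mulFun hy (weakDeriv j F)) p = e j * (p (lastIdx hn) • weakDeriv j F p) := by
    rw [ae_all_iff]
    intro j
    filter_upwards [lmul_ae (e j) (mulFun hy (weakDeriv j F)), mulFun_ae hy (weakDeriv j F)]
      with p h1 h2
    rw [h1, h2]
  filter_upwards [h1, lmul_ae (e (lastIdx hn)) F,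
    Lp.coeFn_sub (∑ j : Fin n, lmul Ω (e j) (mulFun hy (toJet F (some j))))
      (alpha n • lmul Ω (e (lastIdx hn)) (toJet F none)),
    Lp.coeFn_smul (alpha n) (lmul Ω (e (lastIdx hn)) (toJet F none)),
    Lp.coeFn_fun_finsetSum Finset.univ
      fun j : Fin n => lmul Ω (e j) (mulFun hy (toJet F (some j)))] with p h1 h2 h3 h4 h5
  rw [h3, Pi.sub_apply, h4, Pi.smul_apply, h5, diracH, toJet_none, h2]
  simp only [toJet_some, h1]

theorem formQ_eq (s : Cl n) (F G : L2 Ω) :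
    formQ hn Ω s F G = formJet hn hy s (toJet F) (toJet G) := by
  rw [formJet_apply, formQ]
  simp only [pairing_apply, toJet_none, toJet_some]
  congr 1
  · congr 1
    · congr 1
      · refine Finset.sum_congr rfl fun j _ => inner2_congr ?_ Filter.EventuallyEq.rfl
        filter_upwards [mulFun_ae hy (mulFun hy (weakDeriv j F)), mulFun_ae hy (weakDeriv j F)]
          with p h1 h2
        rw [h1, h2, smul_smul, sq]
      · congr 1
        exact inner2_congr (mulFun_ae hy _).symm Filter.EventuallyEq.rfl
    · refine inner2_congr ?_ Filter.EventuallyEq.rfl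
      filter_upwards [lmul_ae (e (lastIdx hn) - algebraMap ℝ (Cl n) (2 * Sc s))
        (diracJet hn hy (toJet F)), diracJet_toJet hn hy F] with p h1 h2
      rw [h1, h2]
  · refine inner2_congr ?_ Filter.EventuallyEq.rfl
    filter_upwards [Lp.coeFn_smul (‖s‖ ^ 2 - beta n) F] with p hp
    rw [hp]
    rfl

end Form

/-! ### Coercivity -/

/-- A binary quadratic form is bounded below by its smallest eigenvalue. -/
theorem min_eigenvalue_le (a b c x y : ℝ) (hb : 0 ≤ b) :
    (1 / 2 * c + 1 / 2 * a - 1 / 2 * √((c - a) ^ 2 + b ^ 2)) * (x ^ 2 + y ^ 2)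
      ≤ a * x ^ 2 - b * (x * y) + c * y ^ 2 := by
  have hS : √((c - a) ^ 2 + b ^ 2) ^ 2 = (c - a) ^ 2 + b ^ 2 := Real.sq_sqrt (by positivity)
  have hle : |c - a| ≤ √((c - a) ^ 2 + b ^ 2) := Real.abs_le_sqrt (by nlinarith [sq_nonneg b])
  set S := √((c - a) ^ 2 + b ^ 2)
  obtain ⟨h1, h2⟩ := abs_le.1 hle
  -- Twice the difference of the two sides is the square (√(S+a-c) x - √(S+c-a) y)²; the cross term
  -- fits because (S+a-c)(S+c-a) = S² - (c-a)² = b².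
  have hp : √(S + (a - c)) ^ 2 = S + (a - c) := Real.sq_sqrt (by linarith)
  have hq : √(S + (c - a)) ^ 2 = S + (c - a) := Real.sq_sqrt (by linarith)
  have hpq : √(S + (a - c)) * √(S + (c - a)) = b := by
    rw [← Real.sqrt_mul (by linarith), show (S + (a - c)) * (S + (c - a)) = b ^ 2 by linarith,
      Real.sqrt_sq hb]
  have := sq_nonneg (√(S + (a - c)) * x - √(S + (c - a)) * y)
  have hexp : (√(S + (a - c)) * x - √(S + (c - a)) * y) ^ 2 =
      (S + (a - c)) * x ^ 2 - 2 * b * (x * y) + (S + (c - a)) * y ^ 2 := by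
    linear_combination x ^ 2 * hp + y ^ 2 * hq - 2 * x * y * hpq
  nlinarith

theorem alpha_nonneg (hn : 2 ≤ n) : 0 ≤ alpha n := by
  have : (2 : ℝ) ≤ n := by exact_mod_cast hn
  rw [alpha]
  linarith

theorem sum_norm_le (U : Jet Ω) :
    ∑ j, ‖U (some j)‖ ≤ √n * √(∑ j, ‖U (some j)‖ ^ 2) := by
  rw [← Real.sqrt_mul (Nat.cast_nonneg n)]
  refine Real.le_sqrt_of_sq_le ?_
  simpa using sq_sum_le_card_mul_sum_sq (s := Finset.univ) (f := fun j => ‖U (some j)‖)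

section

variable (hn : 2 ≤ n) (hy : MemLp (fun p : E n => p (lastIdx hn)) ⊤ (volume.restrict Ω))
  {m M : ℝ}

theorem norm_diracJet_le (hM : ∀ᵐ p ∂volume.restrict Ω, |p (lastIdx hn)| ≤ M) (hM0 : 0 ≤ M)
    (U : Jet Ω) : ‖diracJet hn hy U‖ ≤
      M * (√n * √(∑ j, ‖U (some j)‖ ^ 2)) + alpha n * ‖U none‖ := by
  rw [diracJet_apply]
  refine (norm_sub_le _ _).trans (add_le_add ?_ ?_)
  · refine (norm_sum_le _ _).trans ?_
    calc _ ≤ ∑ j, M * ‖U (some j)‖ := Finset.sum_le_sum fun j _ =>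
          (norm_lmul_e j _).trans (norm_mulFun_le hy hM _)
      _ ≤ _ := by
          rw [← Finset.mul_sum]
          gcongr
          exact sum_norm_le U
  · rw [norm_smul, Real.norm_eq_abs, abs_of_nonneg (alpha_nonneg hn)]
    have := alpha_nonneg hn
    gcongr
    exact norm_lmul_e _ _

theorem K_mul_norm_sq_le (hm : 0 < m) (hm' : ∀ᵐ p ∂volume.restrict Ω, m ≤ |p (lastIdx hn)|)
    (hM : ∀ᵐ p ∂volume.restrict Ω, |p (lastIdx hn)| ≤ M) (hM0 : 0 ≤ M) {s : Cl n}
    (hs : 0 ≤ ‖s‖ ^ 2 - beta n) (U : Jet Ω) :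
    K n m M s * ‖U‖ ^ 2 ≤ Sc (formJet hn hy s U U) := by
  have hα := alpha_nonneg hn
  set r := √(1 + 4 * Sc s ^ 2) with hr
  set d := √(∑ j, ‖U (some j)‖ ^ 2) with hd
  set u := ‖U none‖ with hu
  have hd2 : d ^ 2 = ∑ j, ‖U (some j)‖ ^ 2 :=
    Real.sq_sqrt (Finset.sum_nonneg fun j _ => sq_nonneg _)
  have hr0 : 0 ≤ r := Real.sqrt_nonneg _
  have hd0 : 0 ≤ d := Real.sqrt_nonneg _
  have hu0 : 0 ≤ u := norm_nonneg _
  have h1 : m ^ 2 * d ^ 2 ≤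
      ∑ j, inner ℝ (mulFun hy (mulFun hy (U (some j)))) (U (some j)) := by
    rw [hd2, Finset.mul_sum]
    refine Finset.sum_le_sum fun j _ => ?_
    -- Multiplication by y is self-adjoint, so ⟨y²V, V⟩ = ‖yV‖².
    rw [inner_mulFun_left, real_inner_self_eq_norm_sq, ← mul_pow]
    gcongr
    exact le_norm_mulFun hy hm hm' _
  have h2 : -(M * d * u) ≤ inner ℝ (mulFun hy (U (some (lastIdx hn)))) (U none) := by
    refine (abs_le.1 ((abs_real_inner_le_norm _ _).trans ?_)).1
    gcongr
    refine (norm_mulFun_le hy hM _).trans ?_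
    gcongr
    exact Real.le_sqrt_of_sq_le (Finset.single_le_sum (f := fun j => ‖U (some j)‖ ^ 2)
      (fun j _ => sq_nonneg _) (Finset.mem_univ (lastIdx hn)))
  have h3 : -(r * (M * (√n * d) + alpha n * u) * u) ≤ inner ℝ
      (lmul Ω (e (lastIdx hn) - algebraMap ℝ (Cl n) (2 * Sc s)) (diracJet hn hy U)) (U none) := by
    refine (abs_le.1 ((abs_real_inner_le_norm _ _).trans ?_)).1
    gcongr
    refine (norm_lmul_e_sub _ _ _).trans ?_
    rw [show 1 + (2 * Sc s) ^ 2 = 1 + 4 * Sc s ^ 2 by ring]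
    gcongr
    exact norm_diracJet_le hn hy hM hM0 U
  have h4 : inner ℝ ((‖s‖ ^ 2 - beta n) • U none) (U none) = (‖s‖ ^ 2 - beta n) * u ^ 2 := by
    rw [real_inner_smul_left, real_inner_self_eq_norm_sq]
  have hform : Sc (formJet hn hy s U U) =
      ∑ j, inner ℝ (mulFun hy (mulFun hy (U (some j)))) (U (some j))
      + (2 * (1 + alpha n)) * inner ℝ (mulFun hy (U (some (lastIdx hn)))) (U none)
      + inner ℝ (lmul Ω (e (lastIdx hn) - algebraMap ℝ (Cl n) (2 * Sc s)) (diracJet hn hy U))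
          (U none)
      + (‖s‖ ^ 2 - beta n) * u ^ 2 := by
    rw [formJet_apply, ← h4]
    simp only [← Sc_pairing, ← ScL_apply, map_add, map_sum, map_smul, smul_eq_mul]
  have hK := min_eigenvalue_le (m ^ 2) (M * (2 * (1 + alpha n) + √n * r))
    (‖s‖ ^ 2 - beta n - alpha n * r) d u (by positivity)
  have hKeq : K n m M s = 1 / 2 * (‖s‖ ^ 2 - beta n - alpha n * r) + 1 / 2 * m ^ 2
      - 1 / 2 * √((‖s‖ ^ 2 - beta n - alpha n * r - m ^ 2) ^ 2
        + (M * (2 * (1 + alpha n) + √n * r)) ^ 2) := by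
    rw [K, abs_of_nonneg hs, ← hr, mul_pow M]
    ring
  rw [Jet.norm_sq, ← hd2, add_comm, hKeq, hform]
  have := mul_le_mul_of_nonneg_left h2 (show 0 ≤ 2 * (1 + alpha n) by positivity)
  refine hK.trans ?_
  linarith

/-- The hypotheses of the main theorem force `|s|² > β_n`. -/
theorem beta_lt_norm_sq (hm : 0 < m) (hmM : m ≤ M) {s : Cl n}
    (hs2 : 4 * m ^ 2 * |‖s‖ ^ 2 - beta n| - 4 * n * M ^ 2 * Sc s ^ 2
      - 4 * (m ^ 2 * alpha n + M ^ 2 * (1 + alpha n) * √n) * √(1 + 4 * Sc s ^ 2)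
      > M ^ 2 * (4 * (1 + alpha n) ^ 2 + n)) (hn : 2 ≤ n) : 0 < ‖s‖ ^ 2 - beta n := by
  -- Otherwise | |s|² - β | ≤ β, and with m ≤ M the inequality gives (1+α)² < β = α + α², which is
  -- absurd.
  by_contra! h
  rw [abs_of_nonpos h] at hs2
  have hα := alpha_nonneg hn
  have h1 : 0 ≤ 4 * (n : ℝ) * M ^ 2 * Sc s ^ 2 := by positivity
  have h2 : 0 ≤ 4 * (m ^ 2 * alpha n + M ^ 2 * (1 + alpha n) * √n) * √(1 + 4 * Sc s ^ 2) := by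
    positivity
  have h3 : m ^ 2 ≤ M ^ 2 := by gcongr
  have h4 : m ^ 2 * (4 * (1 + alpha n) ^ 2) ≤ M ^ 2 * (4 * (1 + alpha n) ^ 2 + n) := by
    have : (0 : ℝ) ≤ n := n.cast_nonneg
    gcongr
    linarith
  have h5 : m ^ 2 * (4 * (1 + alpha n) ^ 2) < m ^ 2 * (4 * beta n) := by
    have : 0 ≤ m ^ 2 * ‖s‖ ^ 2 := by positivity
    linarith
  have h6 := lt_of_mul_lt_mul_left h5 (by positivity)
  rw [beta] at h6
  linarith

/-- With c' = | |s|² - β | - αr and b = M(2(1+α) + √n r), the second hypothesis reads 4m²c' > b².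
Equivalently (c' - m²)² + b² < (c' + m²)², and the first hypothesis, c' + m² > 0, allows taking
roots. -/
theorem K_pos {s : Cl n}
    (hs1 : |‖s‖ ^ 2 - beta n| - alpha n * √(1 + 4 * Sc s ^ 2) + m ^ 2 > 0)
    (hs2 : 4 * m ^ 2 * |‖s‖ ^ 2 - beta n| - 4 * n * M ^ 2 * Sc s ^ 2
      - 4 * (m ^ 2 * alpha n + M ^ 2 * (1 + alpha n) * √n) * √(1 + 4 * Sc s ^ 2)
      > M ^ 2 * (4 * (1 + alpha n) ^ 2 + n)) : 0 < K n m M s := by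
  rw [K]
  have hr : √(1 + 4 * Sc s ^ 2) ^ 2 = 1 + 4 * Sc s ^ 2 := Real.sq_sqrt (by positivity)
  have hn : √(n : ℝ) ^ 2 = n := Real.sq_sqrt (by positivity)
  set r := √(1 + 4 * Sc s ^ 2)
  set c := |‖s‖ ^ 2 - beta n|
  have hexp : (2 * (1 + alpha n) + √n * r) ^ 2 =
      4 * (1 + alpha n) ^ 2 + 4 * (1 + alpha n) * √n * r + n * (1 + 4 * Sc s ^ 2) := by
    rw [← hr]
    nth_rewrite 3 [← hn]
    ring
  have : √((c - alpha n * r - m ^ 2) ^ 2 + M ^ 2 * (2 * (1 + alpha n) + √n * r) ^ 2)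
      < c - alpha n * r + m ^ 2 := by
    rw [Real.sqrt_lt' hs1, hexp]
    linarith
  linarith

/-! ### The weak Dirichlet problem -/

/-- In the converse direction the scalar equation is tested against G a for every Clifford number a;
right linearity gives Sc((q_s(F,G) - ⟨f,G⟩) a) = 0, so the bracket vanishes. -/
theorem isWeakSol_iff (hΩ : IsOpen Ω) {s : Cl n} {f : L2 Ω} {U : Jet Ω}
    (hU : U ∈ sobolevJets Ω) : IsWeakSol hn Ω s f (U none) ↔
      ∀ W ∈ sobolevJets Ω, Sc (formJet hn hy s U W) = inner ℝ f (W none) := by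
  have hUeq : toJet (U none) = U := toJet_eq hΩ (isWeakDeriv_of_mem_sobolevJets hU)
  constructor
  · intro h W hW
    have := h.2 _ (mem_H10_of_mem_sobolevJets hΩ hW)
    rw [formQ_eq hn hy, hUeq, toJet_eq hΩ (isWeakDeriv_of_mem_sobolevJets hW)] at this
    rw [this, ← pairing_apply, Sc_pairing]
  · refine fun h => ⟨mem_H10_of_mem_sobolevJets hΩ hU, fun G hG => ?_⟩
    rw [formQ_eq hn hy, hUeq, ← pairing_apply, ← sub_eq_zero]
    refine eq_zero_of_forall_Sc_mul fun a => ?_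
    have := h _ (rmul_mem_sobolevJets a (toJet_mem_sobolevJets hΩ hG))
    rw [formJet_rmul, Jet.rmul_apply, toJet_none, ← Sc_pairing, pairing_rmul] at this
    rw [sub_mul, ← ScL_apply, map_sub, ScL_apply, ScL_apply, this, sub_self]

theorem existsUnique_sobolevJets {s : Cl n} {k : ℝ} (hk : 0 < k)
    (hcoer : ∀ U : Jet Ω, k * ‖U‖ ^ 2 ≤ Sc (formJet hn hy s U U)) (f : L2 Ω) :
    ∃! U : Jet Ω, U ∈ sobolevJets Ω ∧
      ∀ W ∈ sobolevJets Ω, Sc (formJet hn hy s U W) = inner ℝ f (W none) := by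
  let B : sobolevJets Ω →L[ℝ] sobolevJets Ω →L[ℝ] ℝ :=
    ContinuousLinearMap.compL ℝ (sobolevJets Ω) (Cl n) ℝ (ScL n) ∘L
      (formJet hn hy s).bilinearComp (sobolevJets Ω).subtypeL (sobolevJets Ω).subtypeL
  have hB : ∀ U W : sobolevJets Ω, B U W = Sc (formJet hn hy s U W) := fun _ _ => rfl
  have hcoercive : IsCoercive B := ⟨k, hk, fun U => by
    rw [hB, mul_assoc, ← sq]
    exact hcoer U⟩
  let ℓ : sobolevJets Ω →L[ℝ] ℝ :=
    innerSL ℝ f ∘L Jet.proj Ω none ∘L (sobolevJets Ω).subtypeL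
  let U := hcoercive.continuousLinearEquivOfBilin.symm ((InnerProductSpace.toDual ℝ _).symm ℓ)
  have hU : ∀ W ∈ sobolevJets Ω, Sc (formJet hn hy s U W) = inner ℝ f (W none) := by
    intro W hW
    have := hcoercive.continuousLinearEquivOfBilin_apply U ⟨W, hW⟩
    rw [ContinuousLinearEquiv.apply_symm_apply, InnerProductSpace.toDual_symm_apply, hB] at this
    exact this.symm
  refine ⟨U, ⟨U.2, hU⟩, fun U' hU' => ?_⟩
  -- Uniqueness: the difference of two solutions, tested against itself, has zero form, and
  -- coercivity kills it.
  have hmem := Submodule.sub_mem _ hU'.1 U.2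
  have h0 : Sc (formJet hn hy s (U' - U) (U' - U)) = 0 := by
    have hsub : formJet hn hy s (U' - U) (U' - U) =
        formJet hn hy s U' (U' - U) - formJet hn hy s U (U' - U) := by
      rw [(formJet hn hy s).map_sub]
      rfl
    rw [hsub, ← ScL_apply, map_sub, ScL_apply, ScL_apply, hU _ hmem, hU'.2 _ hmem, sub_self]
  have h1 := hcoer (U' - U)
  rw [h0] at h1
  have h2 : ‖U' - U‖ ^ 2 ≤ 0 := nonpos_of_mul_nonpos_right h1 hk
  rw [← sub_eq_zero, ← norm_eq_zero]
  exact pow_eq_zero_iff two_ne_zero |>.1 (le_antisymm h2 (sq_nonneg _))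

theorem norm_le_of_forall_form_eq {s : Cl n} {k : ℝ} (hk : 0 < k)
    (hcoer : ∀ U : Jet Ω, k * ‖U‖ ^ 2 ≤ Sc (formJet hn hy s U U)) {f : L2 Ω} {U : Jet Ω}
    (hU : Sc (formJet hn hy s U U) = inner ℝ f (U none)) : ‖U‖ ≤ 1 / k * ‖f‖ := by
  have h1 : ‖U none‖ ≤ ‖U‖ := PiLp.norm_apply_le U none
  have h2 : k * ‖U‖ ^ 2 ≤ ‖f‖ * ‖U‖ :=
    ((hcoer U).trans (hU.trans_le (real_inner_le_norm _ _))).trans (by gcongr)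
  rw [one_div, ← div_eq_inv_mul, le_div_iff₀ hk]
  rcases (norm_nonneg U).eq_or_lt with h | h
  · rw [← h, zero_mul]
    positivity
  · refine le_of_mul_le_mul_right ?_ h
    linarith

theorem norm_le_norm_toJet (F : L2 Ω) : ‖F‖ ≤ ‖toJet F‖ := PiLp.norm_apply_le (toJet F) none

theorem normD_le_norm_toJet (F : L2 Ω) : normD F ≤ ‖toJet F‖ := by
  rw [norm_toJet, normH1]
  exact Real.le_sqrt_of_sq_le (le_add_of_nonneg_left (sq_nonneg _))

end

end HypDirac

end

theorem mainTheorem1 (n : ℕ) (hn : 2 ≤ n)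
    (Ω : Set (EuclideanSpace ℝ (Fin n))) (hΩ : IsOpen Ω)
    (m M : ℝ) (hm : 0 < m)
    (hinf : IsGLB ((fun p : EuclideanSpace ℝ (Fin n) => p (HypDirac.lastIdx hn)) '' Ω) m)
    (hsup : IsLUB ((fun p : EuclideanSpace ℝ (Fin n) => p (HypDirac.lastIdx hn)) '' Ω) M)
    (s : HypDirac.Cl n) (hs : s ∈ HypDirac.paravectors n)
    (hs0 : ‖s‖ ^ 2 - HypDirac.beta n ≠ 0)
    (hs1 : |‖s‖ ^ 2 - HypDirac.beta n| - HypDirac.alpha n * √(1 + 4 * HypDirac.Sc s ^ 2)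
      + m ^ 2 > 0)
    (hs2 : 4 * m ^ 2 * |‖s‖ ^ 2 - HypDirac.beta n| - 4 * n * M ^ 2 * HypDirac.Sc s ^ 2
      - 4 * (m ^ 2 * HypDirac.alpha n + M ^ 2 * (1 + HypDirac.alpha n) * √n)
          * √(1 + 4 * HypDirac.Sc s ^ 2)
      > M ^ 2 * (4 * (1 + HypDirac.alpha n) ^ 2 + n)) :
    0 < HypDirac.K n m M s ∧
    ∀ f : HypDirac.L2 Ω,
      (∃! F : HypDirac.L2 Ω, HypDirac.IsWeakSol hn Ω s f F) ∧
      ∀ F : HypDirac.L2 Ω, HypDirac.IsWeakSol hn Ω s f F →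
        ‖F‖ ≤ 1 / HypDirac.K n m M s * ‖f‖ ∧
        HypDirac.normD F ≤ 1 / HypDirac.K n m M s * ‖f‖ := by
  open HypDirac in
  have hmy : ∀ p ∈ Ω, m ≤ p (lastIdx hn) := fun p hp => hinf.1 ⟨p, hp, rfl⟩
  have hyM : ∀ p ∈ Ω, p (lastIdx hn) ≤ M := fun p hp => hsup.1 ⟨p, hp, rfl⟩
  -- The empty set has no greatest lower bound in ℝ, so the existence of the infimum makes Ω
  -- non-empty.
  obtain ⟨-, p₀, hp₀, -⟩ := hinf.nonempty
  have hmM : m ≤ M := (hmy p₀ hp₀).trans (hyM p₀ hp₀)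
  have hm' : ∀ᵐ p ∂MeasureTheory.volume.restrict Ω, m ≤ |p (lastIdx hn)| :=
    (MeasureTheory.ae_restrict_iff' hΩ.measurableSet).2
      (.of_forall fun p hp => (hmy p hp).trans (le_abs_self _))
  have hM : ∀ᵐ p ∂MeasureTheory.volume.restrict Ω, |p (lastIdx hn)| ≤ M :=
    (MeasureTheory.ae_restrict_iff' hΩ.measurableSet).2 (.of_forall fun p hp =>
      abs_le.2 ⟨by linarith [hmy p hp], hyM p hp⟩)
  have hy : MeasureTheory.MemLp (fun p : E n => p (lastIdx hn)) ⊤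
      (MeasureTheory.volume.restrict Ω) :=
    MeasureTheory.memLp_top_of_bound (by fun_prop) M hM
  have hK : 0 < K n m M s := K_pos hs1 hs2
  have hcoer := K_mul_norm_sq_le hn hy hm hm' hM (hm.le.trans hmM)
    (beta_lt_norm_sq hm hmM hs2 hn).le
  refine ⟨hK, fun f => ⟨?_, fun F hF => ?_⟩⟩
  · obtain ⟨U, ⟨hU, hUf⟩, huniq⟩ := existsUnique_sobolevJets hn hy hK hcoer f
    refine ⟨U none, (isWeakSol_iff hn hy hΩ hU).2 hUf, fun F hF => ?_⟩
    have hF' := toJet_mem_sobolevJets hΩ hF.1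
    rw [← huniq _ ⟨hF', (isWeakSol_iff hn hy hΩ hF').1 hF⟩]
    rfl
  · have hF' := toJet_mem_sobolevJets hΩ hF.1
    have := norm_le_of_forall_form_eq hn hy hK hcoer
      ((isWeakSol_iff hn hy hΩ hF').1 hF _ hF')
    exact ⟨(norm_le_norm_toJet F).trans this, (normD_le_norm_toJet F).trans this⟩
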